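/- Let $\mathbf{Comp}$ be the category of compact Hausdorff spaces (compacta) and continuous maps. A map $f:X\to Y$ is *skeletal* if $f^{-1}(A)$ is nowhere dense in $X$ for every nowhere dense $A\subset Y$. A commutative square of compacta with maps $p_X:\tilde X\to X$, $\tilde f:\tilde X\to\tilde Y$, $p_Y:\tilde Y\to Y$, $f:X\to Y$ (so $p_Y\circ\tilde f=f\circ p_X$) is *bicommutative* if $\tilde f(p_X^{-1}(x))=p_Y^{-1}(f(x))$ for all $x\in X$. The weight $w(X)$ is the smallest cardinality of a base of $X$. Theorem. Let $F:\mathbf{Comp}\to\mathbf{Comp}$ be a (covariant) functor which is 1-mecw, that is: 1. $F$ sends injective maps to injective maps and surjective maps to surjective maps; 2. $F$ is continuous, i.e. preserves limits of inverse spectra of compacta indexed by non-empty directed partially ordered sets; 3. $F$ preserves finite 1-preimages: it preserves the bicommutativity of those squares in which $f,\tilde f$ are injective, $p_X$ is bijective and $X$ is finite; 4. $w(FX)\le w(X)$ for every infinite compactum $X$. Suppose that $F$ is finitely bicommutative (it preserves the bicommutativity of squares of surjective maps $f,\tilde f,p_X,p_Y$ between finite compacta) and finitely skeletal ($Ff$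 is skeletal for every open surjection $f$ between finite compacta). Then $F$ is skeletal: for every open surjection $f:X\to Y$ between compacta the map $Ff:FX\to FY$ is skeletal; moreover, $Ff$ is skeletal for every skeletal surjection $f:X\to Y$ between compacta. -/

import Mathlib

open CategoryTheory

universe u v

namespace CompFunctor

/-- A map is skeletal if preimages of nowhere dense sets are nowhere dense
(it is only used for continuous maps). -/
def IsSkeletalMap {X : Type u} {Y : Type v} [TopologicalSpace X] [TopologicalSpace Y]
    (f : X → Y) : Prop :=
  ∀ A : Set Y, IsNowhereDense A → IsNowhereDense (f ⁻¹' A)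

/-- The weight of a topological space: the smallest cardinality of a base of its topology. -/
noncomputable def weight (X : Type u) [TopologicalSpace X] : Cardinal.{u} :=
  sInf {c | ∃ B : Set (Set X), TopologicalSpace.IsTopologicalBasis B ∧ Cardinal.mk B = c}

/-- The square with left side `pX : X' ⟶ X`, top `f' : X' ⟶ Y'`, right side `pY : Y' ⟶ Y` and
bottom `f : X ⟶ Y` commutes and satisfies `f' (pX⁻¹ x) = pY⁻¹ (f x)` for all `x` in `X`. -/
structure IsBicommutative {X' X Y' Y : CompHaus.{u}}
    (pX : X' ⟶ X) (f' : X' ⟶ Y') (pY : Y' ⟶ Y) (f : X ⟶ Y) : Prop where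
  comm : f' ≫ pY = pX ≫ f
  image_fiber : ∀ x : X, f' '' (pX ⁻¹' {x}) = pY ⁻¹' {f x}

variable (F : CompHaus.{u} ⥤ CompHaus.{u})

/-- `F` preserves injectivity of maps. -/
def IsMonomorphic : Prop :=
  ∀ ⦃X Y : CompHaus.{u}⦄ (f : X ⟶ Y), Function.Injective f → Function.Injective (F.map f)

/-- `F` preserves surjectivity of maps. -/
def IsEpimorphic : Prop :=
  ∀ ⦃X Y : CompHaus.{u}⦄ (f : X ⟶ Y), Function.Surjective f → Function.Surjective (F.map f)

/-- `F` preserves limits of inverse spectra indexed by (non-empty) directed posets. -/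
def IsContinuous : Prop :=
  ∀ (J : Type u) [PartialOrder J] [IsDirectedOrder J] [Nonempty J],
    Limits.PreservesLimitsOfShape Jᵒᵖ F

/-- `w(FX) ≤ w(X)` for each infinite compactum `X`. -/
def IsWeightPreserving : Prop :=
  ∀ X : CompHaus.{u}, Infinite X → weight (F.obj X) ≤ weight X

/-- `F` preserves the bicommutativity of squares with injective `f`, `f'`, bijective `pX` and
finite `X`. -/
def PreservesFiniteOnePreimages : Prop :=
  ∀ ⦃X' X Y' Y : CompHaus.{u}⦄ (pX : X' ⟶ X) (f' : X' ⟶ Y') (pY : Y' ⟶ Y) (f : X ⟶ Y),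
    Finite X → Function.Injective f → Function.Injective f' → Function.Bijective pX →
    IsBicommutative pX f' pY f →
    IsBicommutative (F.map pX) (F.map f') (F.map pY) (F.map f)

/-- `F` preserves the bicommutativity of squares of surjective maps between finite compacta. -/
def IsFinitelyBicommutative : Prop :=
  ∀ ⦃X' X Y' Y : CompHaus.{u}⦄ (pX : X' ⟶ X) (f' : X' ⟶ Y') (pY : Y' ⟶ Y) (f : X ⟶ Y),
    Finite X' → Finite X → Finite Y' → Finite Y →
    Function.Surjective pX → Function.Surjective f' →
    Function.Surjective pY → Function.Surjective f →
    IsBicommutative pX f' pY f →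
    IsBicommutative (F.map pX) (F.map f') (F.map pY) (F.map f)

/-- `F` sends open surjections between finite compacta to skeletal maps. -/
def IsFinitelySkeletal : Prop :=
  ∀ ⦃X Y : CompHaus.{u}⦄ (f : X ⟶ Y), Finite X → Finite Y →
    Function.Surjective f → IsOpenMap f → IsSkeletalMap (F.map f)

/-- `F` sends open surjections between compacta to skeletal maps. -/
def IsSkeletal : Prop :=
  ∀ ⦃X Y : CompHaus.{u}⦄ (f : X ⟶ Y),
    Function.Surjective f → IsOpenMap f → IsSkeletalMap (F.map f)

/-- `F` sends skeletal surjections between compacta to skeletal maps. -/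
def PreservesSkeletalSurjections : Prop :=
  ∀ ⦃X Y : CompHaus.{u}⦄ (f : X ⟶ Y),
    Function.Surjective f → IsSkeletalMap f → IsSkeletalMap (F.map f)

/-- Mec functors: monomorphic, epimorphic and continuous. -/
structure IsMec : Prop where
  monomorphic : IsMonomorphic F
  epimorphic : IsEpimorphic F
  continuous : IsContinuous F

/-- 1-mec functors: mec functors that preserve finite 1-preimages. -/
structure IsOneMec : Prop extends IsMec F where
  preserves_finite_one_preimages : PreservesFiniteOnePreimages F

/-- 1-mecw functors: 1-mec functors that preserve the weight of infinite compacta. -/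
structure IsOneMecw : Prop extends IsOneMec F where
  weight_preserving : IsWeightPreserving F

end CompFunctor

/-! Between compacta, a map is skeletal exactly when images of nonempty open sets have nonempty
interior. Covering `X` and `Y` by extremally disconnected compacta through irreducible maps `ρ`, `π`
lifts a skeletal `f` to a skeletal surjection `g`, which sends clopen sets to clopen sets
(`exists_extremallyDisconnected_lift`).

By continuity, open sets of `F` of a zero-dimensional compactum come from finite quotients. Hence `F
g` reduces to a map of finite spaces, where finite skeletality gives an open set and finite
bicommutativity, with compactness, lifts it back
(`IsMec.exists_subset_image_map_of_isClopen_image`). Preservation of 1-preimages makes `F π`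
irreducible (`IsOneMec.isIrreducibleMap_map`), so the open set obtained in `F Y'` descends to `F Y`.
-/

namespace CompFunctor

/-! ### Skeletal and irreducible maps -/

section Topology

variable {X : Type u} {Y : Type v} [TopologicalSpace X] [TopologicalSpace Y]

/-- A map is skeletal as soon as images of nonempty open sets have nonempty interior. -/
theorem isSkeletalMap_of_forall_exists_subset_image {f : X → Y} (hf : Continuous f)
    (h : ∀ U : Set X, IsOpen U → U.Nonempty → ∃ V : Set Y, IsOpen V ∧ V.Nonempty ∧ V ⊆ f '' U) :
    IsSkeletalMap f := by
  intro A hA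
  by_contra hne
  obtain ⟨V, hV, hVne, hVU⟩ := h _ isOpen_interior (Set.nonempty_iff_ne_empty.2 hne)
  have hsub : V ⊆ closure A := by
    refine hVU.trans (Set.image_subset_iff.2 ?_)
    exact interior_subset.trans
      (closure_minimal (Set.preimage_mono subset_closure) (isClosed_closure.preimage hf))
  have := interior_maximal hsub hV
  rw [show interior (closure A) = ∅ from hA] at this
  exact hVne.ne_empty (Set.subset_empty_iff.1 this)

/-- Images of nonempty open sets under closed skeletal maps have nonempty interior. -/
theorem IsSkeletalMap.exists_subset_image [CompactSpace X] [T2Space X] {f : X → Y} (hf : IsSkeletalMap f)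
    (hcl : IsClosedMap f) {U : Set X} (hU : IsOpen U) (hne : U.Nonempty) :
    ∃ V : Set Y, IsOpen V ∧ V.Nonempty ∧ V ⊆ f '' U := by
  obtain ⟨x, hx⟩ := hne
  -- With `K` closed, `f '' K` is closed, so it has nonempty interior unless it is nowhere dense.
  obtain ⟨K, hK, hKcl, hKU⟩ := exists_mem_nhds_isClosed_subset (hU.mem_nhds hx)
  refine ⟨interior (f '' K), isOpen_interior, ?_, interior_subset.trans (Set.image_mono hKU)⟩
  by_contra hemp
  have hN : IsNowhereDense (f '' K) :=
    (hcl K hKcl).isNowhereDense_iff.2 (Set.not_nonempty_iff_eq_empty.1 hemp)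
  have hmem : x ∈ interior (closure (f ⁻¹' (f '' K))) :=
    interior_mono ((Set.subset_preimage_image f K).trans subset_closure)
      (mem_interior_iff_mem_nhds.2 hK)
  rw [show interior (closure (f ⁻¹' (f '' K))) = ∅ from hf _ hN] at hmem
  exact hmem

/-- A map is irreducible if every nonempty open set contains the preimage of a nonempty
open set. -/
def IsIrreducibleMap (f : X → Y) : Prop :=
  ∀ U : Set X, IsOpen U → U.Nonempty → ∃ V : Set Y, IsOpen V ∧ V.Nonempty ∧ f ⁻¹' V ⊆ U

theorem IsIrreducibleMap.isSkeletalMap {f : X → Y} (hf : IsIrreducibleMap f)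
    (hc : Continuous f) (hs : Function.Surjective f) : IsSkeletalMap f := by
  refine isSkeletalMap_of_forall_exists_subset_image hc fun U hU hne => ?_
  obtain ⟨V, hV, hVne, hVU⟩ := hf U hU hne
  refine ⟨V, hV, hVne, fun y hy => ?_⟩
  obtain ⟨x, rfl⟩ := hs y
  exact ⟨x, hVU hy, rfl⟩

/-- A closed irreducible surjection sends closed nowhere dense sets to nowhere dense sets. -/
theorem IsIrreducibleMap.isNowhereDense_image {f : X → Y} (hf : IsIrreducibleMap f)
    (hc : Continuous f) (hcl : IsClosedMap f) (hs : Function.Surjective f) {N : Set X}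
    (hN : IsClosed N) (hN' : IsNowhereDense N) : IsNowhereDense (f '' N) := by
  rw [(hcl N hN).isNowhereDense_iff]
  by_contra hne
  set V := interior (f '' N)
  have hVne : V.Nonempty := Set.nonempty_iff_ne_empty.2 hne
  have hVo : IsOpen (f ⁻¹' V) := isOpen_interior.preimage hc
  have hW : (f ⁻¹' V ∩ Nᶜ).Nonempty := by
    by_contra hempty
    have hsub : f ⁻¹' V ⊆ N := fun x hx => by
      by_contra hxN
      exact hempty ⟨x, hx, hxN⟩
    have := interior_maximal hsub hVo
    rw [hN.isNowhereDense_iff.1 hN'] at this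
    obtain ⟨y, hy⟩ := hVne
    obtain ⟨x, rfl⟩ := hs y
    exact this hy
  obtain ⟨V', -, ⟨y, hy⟩, hV'⟩ := hf _ (hVo.inter hN.isOpen_compl) hW
  obtain ⟨x, rfl⟩ := hs y
  obtain ⟨n, hnN, hn⟩ := interior_subset (hV' hy).1
  exact (hV' (show f n ∈ V' from hn ▸ hy)).2 hnN

/-- A skeletal closed map to an extremally disconnected space sends clopen sets to clopen
sets. -/
theorem IsSkeletalMap.isClopen_image [ExtremallyDisconnected Y] {f : X → Y}
    (hf : IsSkeletalMap f) (hc : Continuous f) (hcl : IsClosedMap f) {U : Set X}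
    (hU : IsClopen U) : IsClopen (f '' U) := by
  have hfU : IsClosed (f '' U) := hcl U hU.1
  set C := closure (interior (f '' U))
  have hCo : IsOpen C := ExtremallyDisconnected.open_closure _ isOpen_interior
  have hCsub : C ⊆ f '' U := closure_minimal interior_subset hfU
  -- The preimage of this remainder contains the open set `U \ f ⁻¹' C`, which skeletality forces to
  -- be empty.
  have hN : IsNowhereDense (f '' U \ C) := by
    rw [(hfU.sdiff hCo).isNowhereDense_iff]
    by_contra hne
    obtain ⟨y, hy⟩ := Set.nonempty_iff_ne_empty.2 hne
    have h1 : y ∈ interior (f '' U) := interior_mono Set.sdiff_subset hy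
    exact (interior_subset hy).2 (subset_closure h1)
  have hpre := hf _ hN
  have hO : IsOpen (U \ f ⁻¹' C) := hU.2.sdiff (isClosed_closure.preimage hc)
  have hsub : U \ f ⁻¹' C ⊆ interior (closure (f ⁻¹' (f '' U \ C))) :=
    interior_maximal (fun x hx => subset_closure ⟨⟨x, hx.1, rfl⟩, hx.2⟩) hO
  rw [show interior (closure (f ⁻¹' (f '' U \ C))) = ∅ from hpre] at hsub
  have : f '' U = C := by
    refine Set.Subset.antisymm ?_ hCsub
    rintro _ ⟨x, hx, rfl⟩
    by_contra hxC
    exact hsub ⟨hx, hxC⟩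
  exact ⟨hfU, this ▸ hCo⟩

theorem isSkeletalMap_of_isOpenMap {f : X → Y} (hf : Continuous f) (ho : IsOpenMap f) :
    IsSkeletalMap f :=
  isSkeletalMap_of_forall_exists_subset_image hf fun U hU hne =>
    ⟨f '' U, ho U hU, hne.image f, subset_rfl⟩

end Topology

/-! ### Extremally disconnected covers -/

/-- Every compactum is the image of an extremally disconnected compactum under an irreducible
map. -/
theorem exists_irreducible_extremallyDisconnected_cover (X : CompHaus.{u}) :
    ∃ (E : CompHaus.{u}) (π : E ⟶ X), ExtremallyDisconnected E ∧ Function.Surjective π ∧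
      IsIrreducibleMap π := by
  let P : CompHaus.{u} := Stonean.toCompHaus.obj X.presentation
  let ρ : P ⟶ X := CompHaus.presentation.π X
  have hED : ExtremallyDisconnected P := X.presentation.prop
  have hρ : Function.Surjective ρ := (CompHaus.epi_iff_surjective _).1 inferInstance
  have hρc : Continuous ρ := ρ.hom.hom.continuous
  have hT1 : T1Space X := T2Space.t1Space
  obtain ⟨E, hEc, hE, hmin⟩ := exists_compact_surjective_zorn_subset (A := X) (D := P) hρc hρ
  let σ : E → X := fun e => ρ e
  have hσ : Continuous σ := hρc.comp continuous_subtype_val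
  have hσs : Function.Surjective σ := fun x => by
    obtain ⟨e, he, rfl⟩ : x ∈ ρ '' E := hE ▸ Set.mem_univ x
    exact ⟨⟨e, he⟩, rfl⟩
  have hcl : IsClosedMap σ := hσ.isClosedMap
  have hirr : IsIrreducibleMap σ := fun U hU hne => by
    refine ⟨(σ '' Uᶜ)ᶜ, (hcl _ hU.isClosed_compl).isOpen_compl, ?_, fun x hx => ?_⟩
    · exact Set.nonempty_compl.2 (hmin Uᶜ (Set.compl_ne_univ.2 hne) hU.isClosed_compl)
    · by_contra hxU
      exact hx ⟨x, hxU, rfl⟩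
  have hproj : CompactT2.Projective P := CompactT2.ExtremallyDisconnected.projective
  obtain ⟨r, hr, hrρ⟩ := hproj hρc hσ hσs
  -- A moved point gives a nonempty open `W` with `r` mapping `W` off `W`. But `W` contains a whole
  -- fibre of `σ`, and `r` preserves fibres.
  have hret : ∀ e : E, r e = e := fun e => by
    by_contra hne
    obtain ⟨A, B, hA, hB, hrA, heB, hAB⟩ := t2_separation hne
    let W : Set E := B ∩ (fun e : E => r e) ⁻¹' A
    have hW : IsOpen W := hB.inter (hA.preimage (hr.comp continuous_subtype_val))
    obtain ⟨V, -, ⟨x, hx⟩, hV⟩ := hirr W hW ⟨e, heB, hrA⟩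
    obtain ⟨y, rfl⟩ := hσs x
    have hyW : y ∈ W := hV hx
    have hry : σ (r y) = σ y := congrFun hrρ y
    have hryW : r y ∈ W := hV (show σ (r y) ∈ V from hry ▸ hx)
    exact Set.disjoint_left.1 hAB hyW.2 hryW.1
  have hEproj : CompactT2.Projective E := by
    intro A B _ _ _ _ _ _ f g hf hg hgs
    obtain ⟨h, hh, hgh⟩ := hproj (hf.comp hr) hg hgs
    refine ⟨fun e => h e, hh.comp continuous_subtype_val, funext fun e => ?_⟩
    have := congrFun hgh (e : P)
    simp only [Function.comp_apply, hret] at this ⊢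
    exact this
  exact ⟨CompHaus.of E, CompHausLike.ofHom _ ⟨σ, hσ⟩, hEproj.extremallyDisconnected, hσs, hirr⟩

/-- A skeletal surjection of compacta is covered, via irreducible maps, by a surjection of
extremally disconnected compacta that sends clopen sets to clopen sets. -/
theorem exists_extremallyDisconnected_lift {X Y : CompHaus.{u}} (f : X ⟶ Y)
    (hs : Function.Surjective f) (hf : IsSkeletalMap f) :
    ∃ (X' Y' : CompHaus.{u}) (ρ : X' ⟶ X) (g : X' ⟶ Y') (π : Y' ⟶ Y),
      ExtremallyDisconnected X' ∧ ExtremallyDisconnected Y' ∧ g ≫ π = ρ ≫ f ∧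
      Function.Surjective ρ ∧ Function.Surjective π ∧ IsIrreducibleMap π ∧
      Function.Surjective g ∧ ∀ U : Set X', IsClopen U → IsClopen (g '' U) := by
  obtain ⟨X', ρ, hX', hρ, hρi⟩ := exists_irreducible_extremallyDisconnected_cover X
  obtain ⟨Y', π, hY', hπ, hπi⟩ := exists_irreducible_extremallyDisconnected_cover Y
  have hfc : Continuous f := f.hom.hom.continuous
  have hρc : Continuous ρ := ρ.hom.hom.continuous
  have hπc : Continuous π := π.hom.hom.continuous
  have hproj : CompactT2.Projective X' := CompactT2.ExtremallyDisconnected.projective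
  obtain ⟨g, hg, hgπ⟩ := hproj (hfc.comp hρc) hπc hπ
  have hgπ' : ∀ x, π (g x) = f (ρ x) := fun x => congrFun hgπ x
  have hfρ : IsSkeletalMap (fun x => f (ρ x)) := fun A hA =>
    hρi.isSkeletalMap hρc hρ _ (hf A hA)
  have hgcl : IsClosedMap g := hg.isClosedMap
  have hgs : Function.Surjective g := by
    rw [← Set.range_eq_univ]
    by_contra hne
    obtain ⟨V, -, ⟨y, hy⟩, hV⟩ := hπi _ (isCompact_range hg).isClosed.isOpen_compl
      (Set.nonempty_compl.2 hne)
    obtain ⟨x, rfl⟩ := hs y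
    obtain ⟨x, rfl⟩ := hρ x
    exact hV (show π (g x) ∈ V from hgπ' x ▸ hy) ⟨x, rfl⟩
  -- `g ⁻¹' A` lies in the preimage under `f ∘ ρ` of `π '' closure A`, which is nowhere dense
  -- because `π` is irreducible.
  have hgsk : IsSkeletalMap g := fun A hA => by
    refine (hfρ _ (hπi.isNowhereDense_image hπc hπc.isClosedMap hπ isClosed_closure
      hA.closure)).mono fun x hx => ?_
    exact ⟨g x, subset_closure hx, hgπ' x⟩
  exact ⟨X', Y', ρ, CompHausLike.ofHom _ ⟨g, hg⟩, π, hX', hY',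
    ConcreteCategory.hom_ext _ _ hgπ', hρ, hπ, hπi, hgs,
    fun U hU => hgsk.isClopen_image hg hgcl hU⟩

/-- Pointwise form of the functoriality of `F` on a commutative triangle. -/
theorem map_map_apply (F : CompHaus.{u} ⥤ CompHaus.{u}) {A B C : CompHaus.{u}} (f : A ⟶ B)
    (g : B ⟶ C) {h : A ⟶ C} (w : f ≫ g = h) (a : F.obj A) :
    F.map g (F.map f a) = F.map h a := by
  rw [← w, F.map_comp]
  rfl

/-! ### Finite quotients and the topology of `F X` -/

section FiniteQuotients

variable (X : CompHaus.{u}) [TotallyDisconnectedSpace X]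

/-- The diagram of finite discrete quotients of a zero-dimensional compactum. -/
noncomputable def finiteQuotients : DiscreteQuotient X ⥤ CompHaus.{u} :=
  (Profinite.of X).diagram ⋙ profiniteToCompHaus

/-- The projection of a zero-dimensional compactum to a finite discrete quotient. -/
noncomputable def finiteQuotientProj (S : DiscreteQuotient X) :
    X ⟶ (finiteQuotients X).obj S :=
  profiniteToCompHaus.map ((Profinite.of X).asLimitCone.π.app S)

instance (S : DiscreteQuotient X) : Finite ((finiteQuotients X).obj S) :=
  inferInstanceAs (Finite S)

instance (S : DiscreteQuotient X) : DiscreteTopology ((finiteQuotients X).obj S) :=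
  ⟨rfl⟩

theorem finiteQuotientProj_comp {S T : DiscreteQuotient X} (h : S ⟶ T) :
    finiteQuotientProj X S ≫ (finiteQuotients X).map h = finiteQuotientProj X T :=
  rfl

theorem finiteQuotientProj_surjective (S : DiscreteQuotient X) :
    Function.Surjective (finiteQuotientProj X S) :=
  S.proj_surjective

variable {X} {F : CompHaus.{u} ⥤ CompHaus.{u}}

/-- `F X` is the limit of the images of the finite quotients; points are compared as maps from a
one-point space. -/
theorem IsContinuous.eq_of_forall_finiteQuotientProj (hF : IsContinuous F) {a b : F.obj X}
    (h : ∀ S, F.map (finiteQuotientProj X S) a = F.map (finiteQuotientProj X S) b) : a = b := by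
  have := hF (DiscreteQuotient X)ᵒᵈ
  have e : (DiscreteQuotient X)ᵒᵈᵒᵖ ≌ DiscreteQuotient X :=
    (orderDualEquivalence (DiscreteQuotient X)ᵒᵈ).symm
  have := Limits.preservesLimitsOfShape_of_equiv e F
  have hlim := Limits.isLimitOfPreserves F
    (Limits.isLimitOfPreserves profiniteToCompHaus (Profinite.of X).asLimit)
  let T : CompHaus.{u} := CompHaus.of PUnit.{u + 1}
  have key : CompHausLike.const T a = CompHausLike.const T b := hlim.hom_ext fun S =>
    ConcreteCategory.hom_ext _ _ fun _ => h S
  exact congrArg (fun φ : T ⟶ F.obj X => φ PUnit.unit) key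

/-- The sets of points with prescribed image in the finite quotients form a directed family. -/
theorem directed_fiber_finiteQuotientProj (a : F.obj X) :
    Directed (· ⊇ ·) fun S : DiscreteQuotient X =>
      F.map (finiteQuotientProj X S) ⁻¹' {F.map (finiteQuotientProj X S) a} := by
  have mono : ∀ {S T : DiscreteQuotient X}, S ≤ T →
      F.map (finiteQuotientProj X S) ⁻¹' {F.map (finiteQuotientProj X S) a} ⊆
        F.map (finiteQuotientProj X T) ⁻¹' {F.map (finiteQuotientProj X T) a} := by
    intro S T hST x hx
    simp only [Set.mem_preimage, Set.mem_singleton_iff] at hx ⊢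
    have w := finiteQuotientProj_comp X (homOfLE hST)
    rw [← map_map_apply F _ _ w x, ← map_map_apply F _ _ w a, hx]
  exact fun S T => ⟨S ⊓ T, mono inf_le_left, mono inf_le_right⟩

theorem isClosed_fiber {A B : CompHaus.{u}} (f : A ⟶ B) (b : B) : IsClosed (f ⁻¹' {b}) :=
  haveI : T1Space B := T2Space.t1Space
  isClosed_singleton.preimage f.hom.hom.continuous

/-- The preimages of open sets under the images of the projections to finite quotients form a
base of `F X`. -/
theorem IsContinuous.exists_finiteQuotientProj_preimage_subset (hF : IsContinuous F)
    {U : Set (F.obj X)} (hU : IsOpen U) {a : F.obj X} (ha : a ∈ U) :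
    ∃ (S : DiscreteQuotient X) (V : Set (F.obj ((finiteQuotients X).obj S))), IsOpen V ∧
      F.map (finiteQuotientProj X S) a ∈ V ∧ F.map (finiteQuotientProj X S) ⁻¹' V ⊆ U := by
  obtain ⟨S, hS⟩ := hU.isClosed_compl.isCompact.elim_directed_family_closed
    (fun S : DiscreteQuotient X =>
      F.map (finiteQuotientProj X S) ⁻¹' {F.map (finiteQuotientProj X S) a})
    (fun S => isClosed_fiber _ _)
    (by
      ext x
      simp only [Set.mem_inter_iff, Set.mem_iInter, Set.mem_empty_iff_false, iff_false, not_and]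
      intro hx h
      exact hx (hF.eq_of_forall_finiteQuotientProj h ▸ ha))
    (directed_fiber_finiteQuotientProj a)
  refine ⟨S, (F.map (finiteQuotientProj X S) '' Uᶜ)ᶜ,
    (CompHausLike.isClosedMap _ _ hU.isClosed_compl).isOpen_compl, ?_, fun x hx => ?_⟩
  · rintro ⟨x, hxU, hx⟩
    exact (Set.eq_empty_iff_forall_notMem.1 hS x) ⟨hxU, hx⟩
  · by_contra hxU
    exact hx ⟨x, hxU, rfl⟩

end FiniteQuotients

/-! ### Images as quotients -/

section ImageObjects

variable {X Z : CompHaus.{u}} {T : Type u} [TopologicalSpace T] [T2Space T]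

/-- The image of a compactum under a continuous map to a Hausdorff space. -/
def imageObj (φ : C(X, T)) : CompHaus.{u} :=
  haveI : CompactSpace (Set.range φ) := isCompact_iff_compactSpace.1 (isCompact_range φ.continuous)
  CompHaus.of (Set.range φ)

/-- The projection of a compactum onto its image. -/
def toImageObj (φ : C(X, T)) : X ⟶ imageObj φ :=
  haveI : CompactSpace (Set.range φ) := isCompact_iff_compactSpace.1 (isCompact_range φ.continuous)
  CompHausLike.ofHom _ ⟨fun x => ⟨φ x, x, rfl⟩, φ.continuous.subtype_mk _⟩

/-- The restriction of a continuous map to an image. -/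
def imageObjMap (φ : C(X, T)) (ψ : C(T, Z)) : imageObj φ ⟶ Z :=
  haveI : CompactSpace (Set.range φ) := isCompact_iff_compactSpace.1 (isCompact_range φ.continuous)
  CompHausLike.ofHom _ ⟨fun t => ψ t.1, ψ.continuous.comp continuous_subtype_val⟩

theorem toImageObj_surjective (φ : C(X, T)) : Function.Surjective (toImageObj φ) := by
  rintro ⟨_, x, rfl⟩
  exact ⟨x, rfl⟩

theorem toImageObj_eq_iff (φ : C(X, T)) {x y : X} :
    toImageObj φ x = toImageObj φ y ↔ φ x = φ y :=
  Subtype.ext_iff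

instance [Finite T] (φ : C(X, T)) : Finite (imageObj φ) :=
  inferInstanceAs (Finite (Set.range φ))

end ImageObjects

/-! ### Preservation by the functor -/

variable {F : CompHaus.{u} ⥤ CompHaus.{u}}

/-- A mec functor preserving finite 1-preimages preserves irreducible maps of zero-dimensional
compacta. -/
theorem IsOneMec.isIrreducibleMap_map (hF : IsOneMec F) {E Y : CompHaus.{u}}
    [TotallyDisconnectedSpace E] (π : E ⟶ Y) (hs : Function.Surjective π)
    (hπ : IsIrreducibleMap π) : IsIrreducibleMap (F.map π) := by
  rintro U hU ⟨u, hu⟩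
  obtain ⟨S, U₀, hU₀, huU₀, hU₀U⟩ :=
    hF.continuous.exists_finiteQuotientProj_preimage_subset hU hu
  let D := (finiteQuotients E).obj S
  let p : E ⟶ D := finiteQuotientProj E S
  have hp : Continuous p := p.hom.hom.continuous
  -- Irreducibility finds, for each `d`, a whole fibre of `π` inside `p ⁻¹' {d}`.
  have hsec : ∀ d : D, ∃ e : E, ∀ e' : E, π e' = π e → p e' = d := fun d => by
    obtain ⟨V, -, ⟨y, hy⟩, hV⟩ := hπ (p ⁻¹' {d}) ((isOpen_discrete _).preimage hp)
      (finiteQuotientProj_surjective E S d)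
    obtain ⟨e, rfl⟩ := hs y
    exact ⟨e, fun e' he' => hV (show π e' ∈ V from he' ▸ hy)⟩
  choose s hsp using hsec
  let σ : D ⟶ E := ConcreteCategory.ofHom ⟨s, continuous_of_discreteTopology⟩
  have hpσ : ∀ d, p (σ d) = d := fun d => hsp d _ rfl
  -- In the image of `φ`, the fibre over `π (σ d)` is a single point, so the square below is a
  -- finite 1-preimage.
  let φ : C(E, Y × D) := ⟨fun e => (π e, p e), π.hom.hom.continuous.prodMk hp⟩
  let q : E ⟶ imageObj φ := toImageObj φ
  let πZ : imageObj φ ⟶ Y := imageObjMap φ ⟨Prod.fst, continuous_fst⟩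
  let pZ : imageObj φ ⟶ D := imageObjMap φ ⟨Prod.snd, continuous_snd⟩
  have hqπ : q ≫ πZ = π := rfl
  have hqp : q ≫ pZ = p := rfl
  have hbic : IsBicommutative (𝟙 D) (σ ≫ q) πZ (σ ≫ π) := by
    refine ⟨rfl, fun d => Set.Subset.antisymm ?_ ?_⟩
    · rintro _ ⟨d', hd', rfl⟩
      obtain rfl : d' = d := hd'
      rfl
    · intro z hz
      obtain ⟨e, rfl⟩ := toImageObj_surjective φ z
      have hz' : π e = π (σ d) := hz
      refine ⟨d, rfl, (toImageObj_eq_iff φ).2 (Prod.ext hz'.symm ?_)⟩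
      exact (hpσ d).trans (hsp d e hz').symm
  have hinj : Function.Injective (σ ≫ π) := fun d d' h => by
    have h' : π (σ d) = π (σ d') := h
    exact (hpσ d).symm.trans (hsp d' _ h')
  have hinj' : Function.Injective (σ ≫ q) := fun d d' h =>
    hinj (congrArg πZ h)
  have hbicF := hF.preserves_finite_one_preimages (𝟙 D) (σ ≫ q) πZ (σ ≫ π) inferInstance
    hinj hinj' Function.bijective_id hbic
  let a : F.obj D := F.map p u
  have hσp : σ ≫ p = 𝟙 D := ConcreteCategory.hom_ext _ _ hpσ
  have hK := CompHausLike.isClosedMap (F.map πZ) (F.map pZ ⁻¹' U₀)ᶜ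
    (hU₀.preimage (F.map pZ).hom.hom.continuous).isClosed_compl
  -- Over `F.map (σ ≫ π) a` the fibre of `F.map πZ` is the single point `F.map (σ ≫ q) a`, sent by
  -- `F.map pZ` to `a ∈ U₀`.
  refine ⟨_, hK.isOpen_compl, ⟨F.map (σ ≫ π) a, ?_⟩, fun x hx => ?_⟩
  · rintro ⟨z, hz, hza⟩
    have hz' : z ∈ F.map πZ ⁻¹' {F.map (σ ≫ π) a} := hza
    rw [← hbicF.image_fiber a] at hz'
    obtain ⟨a', ha', rfl⟩ := hz'
    have ha'' : a' = a := by
      have := map_map_apply F (𝟙 D) (𝟙 D) (Category.comp_id _) a'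
      rw [F.map_id] at ha'
      exact ha'
    refine hz ?_
    change F.map pZ (F.map (σ ≫ q) a') ∈ U₀
    rw [map_map_apply F (σ ≫ q) pZ (h := 𝟙 D) hσp, F.map_id, ha'']
    exact huU₀
  · refine hU₀U ?_
    by_contra hxU
    refine hx ⟨F.map q x, fun h => hxU ?_, map_map_apply F q πZ hqπ x⟩
    change F.map pZ (F.map q x) ∈ U₀ at h
    rwa [map_map_apply F q pZ hqp] at h

/-- The image under `F` of a surjective square from a map of zero-dimensional compacta to a map
of finite compacta is bicommutative if the square is. -/
theorem IsMec.exists_lift_of_finite_quotient (hF : IsMec F) (hbic : IsFinitelyBicommutative F)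
    {X Y X₁ Y₀ : CompHaus.{u}} [TotallyDisconnectedSpace Y] [Finite X₁] [Finite Y₀]
    (g : X ⟶ Y) (p : X ⟶ X₁) (q : Y ⟶ Y₀) (g₁ : X₁ ⟶ Y₀) (w : g ≫ q = p ≫ g₁)
    (hg : Function.Surjective g) (hp : Function.Surjective p) (hq : Function.Surjective q)
    (hlift : ∀ x y, g₁ (p x) = q y → ∃ x', p x' = p x ∧ g x' = y)
    {a : F.obj X₁} {b : F.obj Y} (hab : F.map g₁ a = F.map q b) :
    ∃ c : F.obj X, F.map p c = a ∧ F.map g c = b := by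
  let C : DiscreteQuotient Y → Set (F.obj X) := fun S =>
    F.map p ⁻¹' {a} ∩ F.map g ⁻¹'
      (F.map (finiteQuotientProj Y S) ⁻¹' {F.map (finiteQuotientProj Y S) b})
  have hCcl : ∀ S, IsClosed (C S) := fun S =>
    (isClosed_fiber _ _).inter ((isClosed_fiber _ _).preimage (F.map g).hom.hom.continuous)
  have hCdir : Directed (· ⊇ ·) C := by
    intro S T
    obtain ⟨R, hS, hT⟩ := directed_fiber_finiteQuotientProj b S T
    exact ⟨R, Set.inter_subset_inter_right _ (Set.preimage_mono hS),
      Set.inter_subset_inter_right _ (Set.preimage_mono hT)⟩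
  -- Refine `q` by `S` to a finite quotient `Y'`, and `p` by `Y'` to `X'`; `hlift` makes the
  -- resulting finite square bicommutative.
  have hCne : ∀ S, (C S).Nonempty := fun S => by
    let D := (finiteQuotients Y).obj S
    let pD : Y ⟶ D := finiteQuotientProj Y S
    let φ : C(Y, Y₀ × D) :=
      ⟨fun y => (q y, pD y), q.hom.hom.continuous.prodMk pD.hom.hom.continuous⟩
    let Y' := imageObj φ
    let q' : Y ⟶ Y' := toImageObj φ
    let r : Y' ⟶ Y₀ := imageObjMap φ ⟨Prod.fst, continuous_fst⟩
    let rD : Y' ⟶ D := imageObjMap φ ⟨Prod.snd, continuous_snd⟩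
    let ψ : C(X, X₁ × Y') :=
      ⟨fun x => (p x, q' (g x)),
        p.hom.hom.continuous.prodMk (q'.hom.hom.continuous.comp g.hom.hom.continuous)⟩
    let X' := imageObj ψ
    let p' : X ⟶ X' := toImageObj ψ
    let t : X' ⟶ X₁ := imageObjMap ψ ⟨Prod.fst, continuous_fst⟩
    let g' : X' ⟶ Y' := imageObjMap ψ ⟨Prod.snd, continuous_snd⟩
    have hw : ∀ x, q (g x) = g₁ (p x) := fun x => CategoryTheory.congr_fun w x
    have hp' : Function.Surjective p' := toImageObj_surjective ψ
    have hq' : Function.Surjective q' := toImageObj_surjective φ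
    have ht : Function.Surjective t := fun z => by
      obtain ⟨x, rfl⟩ := hp z
      exact ⟨p' x, rfl⟩
    have hg' : Function.Surjective g' := fun z => by
      obtain ⟨y, rfl⟩ := hq' z
      obtain ⟨x, rfl⟩ := hg y
      exact ⟨p' x, rfl⟩
    have hr : Function.Surjective r := fun z => by
      obtain ⟨y, rfl⟩ := hq z
      exact ⟨q' y, rfl⟩
    have hg₁ : Function.Surjective g₁ := fun z => by
      obtain ⟨y, rfl⟩ := hq z
      obtain ⟨x, rfl⟩ := hg y
      exact ⟨p x, (hw x).symm⟩
    have hsq : IsBicommutative t g' r g₁ := by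
      have hcomm : ∀ z, r (g' z) = g₁ (t z) := fun z => by
        obtain ⟨x, rfl⟩ := hp' z
        exact hw x
      refine ⟨ConcreteCategory.hom_ext _ _ hcomm, fun z => Set.Subset.antisymm ?_ ?_⟩
      · rintro _ ⟨z', hz', rfl⟩
        have hz'' : t z' = z := hz'
        exact (hcomm z').trans (congrArg _ hz'')
      · intro y' hy'
        obtain ⟨y, rfl⟩ := hq' y'
        obtain ⟨x, rfl⟩ := hp z
        have hy'' : q y = g₁ (p x) := hy'
        obtain ⟨x', hx', rfl⟩ := hlift x y hy''.symm
        exact ⟨p' x', hx', rfl⟩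
    have hsqF := hbic t g' r g₁ inferInstance inferInstance inferInstance inferInstance
      ht hg' hr hg₁ hsq
    have hb : F.map q' b ∈ F.map r ⁻¹' {F.map g₁ a} :=
      (map_map_apply F q' r (h := q) rfl b).trans hab.symm
    rw [← hsqF.image_fiber a] at hb
    obtain ⟨c', hc', hc'b⟩ := hb
    obtain ⟨c, rfl⟩ := hF.epimorphic p' hp' c'
    have hc'' : F.map t (F.map p' c) = a := hc'
    refine ⟨c, (map_map_apply F p' t (h := p) rfl c).symm.trans hc'', ?_⟩
    change F.map pD (F.map g c) = F.map pD b
    rw [← map_map_apply F q' rD (h := pD) rfl b, ← hc'b,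
      map_map_apply F p' g' (h := g ≫ q') rfl c, ← map_map_apply F g q' rfl c]
    exact (map_map_apply F q' rD (h := pD) rfl (F.map g c)).symm
  obtain ⟨c, hc⟩ := IsCompact.nonempty_iInter_of_directed_nonempty_isCompact_isClosed C hCdir hCne
    (fun S => (hCcl S).isCompact) hCcl
  rw [Set.mem_iInter] at hc
  exact ⟨c, (hc ⊤).1, hF.continuous.eq_of_forall_finiteQuotientProj fun S => (hc S).2⟩

/-- A finitely bicommutative finitely skeletal mec functor sends surjections of zero-dimensional
compacta that preserve clopen sets to maps under which images of nonempty open sets have nonempty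
interior. -/
theorem IsMec.exists_subset_image_map_of_isClopen_image (hF : IsMec F)
    (hbic : IsFinitelyBicommutative F) (hskel : IsFinitelySkeletal F) {X Y : CompHaus.{u}}
    [TotallyDisconnectedSpace X] [TotallyDisconnectedSpace Y] (g : X ⟶ Y)
    (hg : Function.Surjective g) (hcl : ∀ U : Set X, IsClopen U → IsClopen (g '' U))
    {U : Set (F.obj X)} (hU : IsOpen U) (hne : U.Nonempty) :
    ∃ V : Set (F.obj Y), IsOpen V ∧ V.Nonempty ∧ V ⊆ F.map g '' U := by
  classical
  obtain ⟨u, hu⟩ := hne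
  obtain ⟨S, U₀, hU₀, huU₀, hU₀U⟩ :=
    hF.continuous.exists_finiteQuotientProj_preimage_subset hU hu
  let D := (finiteQuotients X).obj S
  let p₀ : X ⟶ D := finiteQuotientProj X S
  have hp₀ : Continuous p₀ := p₀.hom.hom.continuous
  have hfib : ∀ d : D, IsClopen (g '' (p₀ ⁻¹' {d})) := fun d =>
    hcl _ ((isClopen_discrete _).preimage hp₀)
  -- Recording which sets `g '' (p₀ ⁻¹' {d})` contain `y` is just enough for `hlift`: if `q y = q (g
  -- x)`, then `y` has a preimage in the `p₀`-class of `x`.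
  let φ : C(Y, D → ULift.{u} Bool) :=
    ⟨fun y d => ⟨(g '' (p₀ ⁻¹' {d})).boolIndicator y⟩,
      continuous_pi fun d => continuous_uliftUp.comp
        ((continuous_boolIndicator_iff_isClopen _).2 (hfib d))⟩
  have hφ : ∀ {y y' : Y}, φ y = φ y' → ∀ d, y ∈ g '' (p₀ ⁻¹' {d}) → y' ∈ g '' (p₀ ⁻¹' {d}) := by
    intro y y' h d hy
    have h1 := congrArg ULift.down (congrFun h d)
    have h2 : (g '' (p₀ ⁻¹' {d})).boolIndicator y = (g '' (p₀ ⁻¹' {d})).boolIndicator y' := h1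
    rw [Set.mem_iff_boolIndicator] at hy ⊢
    exact h2 ▸ hy
  let q : Y ⟶ imageObj φ := toImageObj φ
  let ψ : C(X, D × imageObj φ) :=
    ⟨fun x => (p₀ x, q (g x)), hp₀.prodMk (q.hom.hom.continuous.comp g.hom.hom.continuous)⟩
  let p : X ⟶ imageObj ψ := toImageObj ψ
  let t : imageObj ψ ⟶ D := imageObjMap ψ ⟨Prod.fst, continuous_fst⟩
  let g₁ : imageObj ψ ⟶ imageObj φ := imageObjMap ψ ⟨Prod.snd, continuous_snd⟩
  have hp : Function.Surjective p := toImageObj_surjective ψ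
  have hq : Function.Surjective q := toImageObj_surjective φ
  have hg₁ : Function.Surjective g₁ := fun z => by
    obtain ⟨y, rfl⟩ := hq z
    obtain ⟨x, rfl⟩ := hg y
    exact ⟨p x, rfl⟩
  have hlift : ∀ x y, g₁ (p x) = q y → ∃ x', p x' = p x ∧ g x' = y := fun x y hxy => by
    have hxy' : q (g x) = q y := hxy
    obtain ⟨x', hx', rfl⟩ := hφ ((toImageObj_eq_iff φ).1 hxy') (p₀ x) ⟨x, rfl, rfl⟩
    exact ⟨x', (toImageObj_eq_iff ψ).2 (Prod.ext hx' hxy'.symm), rfl⟩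
  have hT1 : T1Space (imageObj φ) := T2Space.t1Space
  have hdisc : DiscreteTopology (imageObj φ) := Finite.instDiscreteTopology
  have hsk : IsSkeletalMap (F.map g₁) := hskel g₁ inferInstance inferInstance hg₁ fun s _ =>
    isOpen_discrete _
  let U₁ : Set (F.obj (imageObj ψ)) := F.map t ⁻¹' U₀
  have hU₁ : IsOpen U₁ := hU₀.preimage (F.map t).hom.hom.continuous
  have hu₁ : F.map p u ∈ U₁ := by
    change F.map t (F.map p u) ∈ U₀
    rwa [map_map_apply F p t (h := p₀) rfl]
  obtain ⟨V, hV, ⟨v, hv⟩, hVU⟩ :=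
    hsk.exists_subset_image (CompHausLike.isClosedMap _) hU₁ ⟨_, hu₁⟩
  obtain ⟨y, rfl⟩ := hF.epimorphic q hq v
  refine ⟨F.map q ⁻¹' V, hV.preimage (F.map q).hom.hom.continuous, ⟨y, hv⟩, fun b hb => ?_⟩
  obtain ⟨a, ha, hab⟩ := hVU hb
  obtain ⟨c, rfl, rfl⟩ := hF.exists_lift_of_finite_quotient hbic g p q g₁ rfl hg hp hq hlift hab
  refine ⟨c, hU₀U ?_, rfl⟩
  rw [Set.mem_preimage, ← map_map_apply F p t (h := p₀) rfl]
  exact ha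

theorem IsOneMec.preservesSkeletalSurjections (hF : IsOneMec F)
    (hbic : IsFinitelyBicommutative F) (hskel : IsFinitelySkeletal F) :
    PreservesSkeletalSurjections F := by
  intro X Y f hs hf
  obtain ⟨X', Y', ρ, g, π, hX', hY', w, hρ, hπ, hπi, hg, hcl⟩ :=
    exists_extremallyDisconnected_lift f hs hf
  refine isSkeletalMap_of_forall_exists_subset_image (F.map f).hom.hom.continuous
    fun U hU hne => ?_
  have hρs := hF.epimorphic ρ hρ
  obtain ⟨W, hW, hWne, hWU⟩ := hF.toIsMec.exists_subset_image_map_of_isClopen_image hbic hskel g hg hcl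
    (hU.preimage (F.map ρ).hom.hom.continuous) (hne.preimage hρs)
  -- Irreducibility puts the whole preimage of `V` in `W`, so any lift of `y ∈ V` to `F Y'` lies in
  -- the image of `F.map g`.
  obtain ⟨V, hV, hVne, hVW⟩ := hF.isIrreducibleMap_map π hπ hπi W hW hWne
  refine ⟨V, hV, hVne, fun y hy => ?_⟩
  obtain ⟨z, rfl⟩ := hF.epimorphic π hπ y
  obtain ⟨x, hx, rfl⟩ := hWU (hVW hy)
  refine ⟨F.map ρ x, hx, ?_⟩
  rw [map_map_apply F g π w, map_map_apply F ρ f rfl]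

end CompFunctor

theorem theorem1p3 (F : CompHaus.{u} ⥤ CompHaus.{u})
    (hF : CompFunctor.IsOneMecw F)
    (hbic : CompFunctor.IsFinitelyBicommutative F)
    (hskel : CompFunctor.IsFinitelySkeletal F) :
    CompFunctor.IsSkeletal F ∧ CompFunctor.PreservesSkeletalSurjections F := by
  have h := hF.toIsOneMec.preservesSkeletalSurjections hbic hskel
  exact ⟨fun X Y f hs ho =>
    h f hs (CompFunctor.isSkeletalMap_of_isOpenMap f.hom.hom.continuous ho), h⟩
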